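/- Let $\mathbb N=\{0,1,2,\ldots\}$ and $\mathbb Z^+=\{1,2,3,\ldots\}$. The following assertions hold. (i) Any $n\in\mathbb Z^+$ can be written as $x^2+y^2+z^2+2w^2$ with $x,y,z,w\in\mathbb N$ and $x-y=1$. Also, any $n\in\mathbb Z^+$ can be written as $x^2+2y^2+2z^2+2w^2$ with $x,y,z,w\in\mathbb Z$ and $x+y+z=1$. (ii) Any $n\in\mathbb Z^+$ can be written as $x^2+y^2+z^2+2w^2$ with $x,y,z,w\in\mathbb Z$ and $x+y+2z=1$. Also, any $n\in\mathbb Z^+$ can be written as $x^2+4y^2+z^2+2w^2$ with $x,y,z,w\in\mathbb Z$ and $x+2y+2z=1$, and any $n\in\mathbb Z^+$ can be written as $x^2+2y^2+2z^2+2w^2$ with $x,y,z,w\in\mathbb Z$ and $x+y+3z=1$. (iii) Any $n\in\mathbb Z^+$ can be written as $x^2+y^2+z^2+2w^2$ with $x,y,z,w\in\mathbb Z$ and $y+z+2w=1$. Also, any $n\in\mathbb Z^+$ can be written as $x^2+y^2+4z^2+2w^2$ with $x,y,z,w\in\mathbb Z$ and $y+2z+2w=1$, and any $n\in\mathbb Z^+$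 can be written as $x^2+2y^2+2z^2+2w^2$ with $x,y,z,w\in\mathbb Z$ and $x+y+z+2w=1$. (iv) Any $n\in\mathbb Z^+$ can be written as $x^2+y^2+z^2+2w^2$ with $x,y,z,w\in\mathbb Z$ and $y+z+w=1$. (v) Any $n\in\mathbb Z^+$ can be written as $x^2+y^2+2z^2+5w^2$ with $x,y,z,w\in\mathbb Z$ and $y+w=1$. If any positive integer congruent to $1$ modulo $7$ can be written as $x^2+7y^2+14z^2$ with $x,y,z\in\mathbb Z$, then any $n\in\mathbb Z^+$ can be written as $x^2+y^2+2z^2+6w^2$ with $x,y,z,w\in\mathbb Z$ and $y+w=1$. (vi) Any $n\in\mathbb Z^+$ can be written as $x^2+y^2+z^2+3w^2$ with $x,y,z,w\in\mathbb Z$ and $x+y+2z=2$. (vii) Any integer $n>4$ can be written as $x^2+y^2+z^2+2w^2$ with $x,y,z,w\in\mathbb Z$ such that $x+y+z=t^2$ for some $t\in\{1,2\}$. (viii) Any integer $n>7$ can be written as $x^2+y^2+z^2+2w^2$ with $x,y,z,w\in\mathbb Z$ such that $x+y+2z=2t^2$ for some $t\in\{1,2\}$. -/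

import Mathlib

/-! Solving the linear constraint for one variable and completing the square turns each assertion
into a representation of a number `M = αn - β` by a diagonal ternary form, together with a
congruence on the first coordinate. The congruence comes from residues and a choice of sign. The
auxiliary forms are `x² + 2y² + 4z²`, `x² + 6y² + 6z²`, `x² + 6y² + 9z²`, `x² + 6y² + 12z²`, `x² +
3y² + 3z²`, and `x² + 5y² + 10z²` for `2M`; only `x² + 7y² + 14z²` is left as a hypothesis.

These diagonal forms are descended by elementary substitutions from ternary forms of
half-discriminant 2, 3, 5 and 6, treated as in the Dirichlet–Ankeny proof of the three-squares
theorem. To represent a target `c`, look for a positive definite form with `c` as a diagonal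
coefficient and half-discriminant `d` (`exists_posDef`). This needs `D`, `b`, `s` with `4cD - b s² =
d` and `-D` a square modulo `b`. Let `D` run through an arithmetic progression; then `b` is `p` or
`2p` with `p` in a progression, Dirichlet's theorem makes `p` prime, and Jacobi reciprocity gives
the residue condition because the equation fixes `p` modulo `D` up to a known factor.

Minkowski reduction then identifies the form: `2abc ≤ disc ≤ 7` leaves finitely many reduced forms.
For `d = 2, 3, 5` they are a single class; for `d = 6` there are two classes, separated by binary
minors modulo 3. -/

/-! ### Integral ternary quadratic forms -/

/-- The form `a x² + b y² + c z² + r y z + s x z + t x y`. -/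
@[ext]
structure TernaryForm where
  a : ℤ
  b : ℤ
  c : ℤ
  r : ℤ
  s : ℤ
  t : ℤ

namespace TernaryForm

def eval (f : TernaryForm) (x y z : ℤ) : ℤ :=
  f.a * x ^ 2 + f.b * y ^ 2 + f.c * z ^ 2 + f.r * (y * z) + f.s * (x * z) + f.t * (x * y)

/-- Half the determinant of the Hessian matrix. -/
def disc (f : TernaryForm) : ℤ :=
  4 * f.a * f.b * f.c + f.r * f.s * f.t - f.a * f.r ^ 2 - f.b * f.s ^ 2 - f.c * f.t ^ 2

def PosDef (f : TernaryForm) : Prop :=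
  ∀ x y z : ℤ, (x ≠ 0 ∨ y ≠ 0 ∨ z ≠ 0) → 0 < f.eval x y z

def Represents (f : TernaryForm) (n : ℤ) : Prop := ∃ x y z : ℤ, f.eval x y z = n

/-- The Gram determinant of two vectors, for the polar form of `f`. -/
def minor (f : TernaryForm) (x y z x' y' z' : ℤ) : ℤ :=
  4 * f.eval x y z * f.eval x' y' z' -
    (f.eval (x + x') (y + y') (z + z') - f.eval x y z - f.eval x' y' z') ^ 2

/-- Some binary minor of `f` is `1` modulo `3`. -/
def HasMinorOne (f : TernaryForm) : Prop :=
  ∃ x y z x' y' z' : ℤ, 3 ∣ f.minor x y z x' y' z' - 1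

def swapXY (f : TernaryForm) : TernaryForm := ⟨f.b, f.a, f.c, f.s, f.r, f.t⟩

def swapYZ (f : TernaryForm) : TernaryForm := ⟨f.a, f.c, f.b, f.r, f.t, f.s⟩

def negX (f : TernaryForm) : TernaryForm := ⟨f.a, f.b, f.c, f.r, -f.s, -f.t⟩

/-- The substitution `x ↦ x + y`. -/
def shear (f : TernaryForm) : TernaryForm :=
  ⟨f.a, f.a + f.b + f.t, f.c, f.r + f.s, f.s, f.t + 2 * f.a⟩

lemma eval_swapXY (f : TernaryForm) (x y z : ℤ) : f.swapXY.eval x y z = f.eval y x z := by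
  simp only [eval, swapXY]; ring

lemma eval_swapYZ (f : TernaryForm) (x y z : ℤ) : f.swapYZ.eval x y z = f.eval x z y := by
  simp only [eval, swapYZ]; ring

lemma eval_negX (f : TernaryForm) (x y z : ℤ) : f.negX.eval x y z = f.eval (-x) y z := by
  simp only [eval, negX]; ring

lemma eval_shear (f : TernaryForm) (x y z : ℤ) : f.shear.eval x y z = f.eval (x + y) y z := by
  simp only [eval, shear]; ring

/-- Proper or improper equivalence over `ℤ`, through generators of `GL₃(ℤ)`. -/
inductive Equivalent (f : TernaryForm) : TernaryForm → Prop
  | refl : Equivalent f f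
  | swapXY {g : TernaryForm} : Equivalent f g → Equivalent f g.swapXY
  | swapYZ {g : TernaryForm} : Equivalent f g → Equivalent f g.swapYZ
  | negX {g : TernaryForm} : Equivalent f g → Equivalent f g.negX
  | shear {g : TernaryForm} : Equivalent f g → Equivalent f g.shear

namespace Equivalent

variable {f g : TernaryForm}

lemma disc_eq (h : Equivalent f g) : g.disc = f.disc := by
  induction h with
  | refl => rfl
  | swapXY _ ih => rw [← ih]; simp only [disc, TernaryForm.swapXY]; ring
  | swapYZ _ ih => rw [← ih]; simp only [disc, TernaryForm.swapYZ]; ring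
  | negX _ ih => rw [← ih]; simp only [disc, TernaryForm.negX]; ring
  | shear _ ih => rw [← ih]; simp only [disc, TernaryForm.shear]; ring

lemma posDef (h : Equivalent f g) (hf : f.PosDef) : g.PosDef := by
  induction h with
  | refl => exact hf
  | swapXY _ ih => intro x y z hx; rw [eval_swapXY]; exact ih _ _ _ (by tauto)
  | swapYZ _ ih => intro x y z hx; rw [eval_swapYZ]; exact ih _ _ _ (by tauto)
  | negX _ ih => intro x y z hx; rw [eval_negX]; exact ih _ _ _ (by omega)
  | shear _ ih => intro x y z hx; rw [eval_shear]; exact ih _ _ _ (by omega)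

lemma represents (h : Equivalent f g) {n : ℤ} (hf : f.Represents n) : g.Represents n := by
  induction h with
  | refl => exact hf
  | swapXY _ ih =>
    obtain ⟨x, y, z, h⟩ := ih
    exact ⟨y, x, z, by rw [eval_swapXY, h]⟩
  | swapYZ _ ih =>
    obtain ⟨x, y, z, h⟩ := ih
    exact ⟨x, z, y, by rw [eval_swapYZ, h]⟩
  | negX _ ih =>
    obtain ⟨x, y, z, h⟩ := ih
    exact ⟨-x, y, z, by rw [eval_negX, neg_neg, h]⟩
  | shear _ ih =>
    obtain ⟨x, y, z, h⟩ := ih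
    exact ⟨x - y, y, z, by rw [eval_shear, sub_add_cancel, h]⟩

lemma hasMinorOne (h : Equivalent f g) (hf : f.HasMinorOne) : g.HasMinorOne := by
  induction h with
  | refl => exact hf
  | swapXY _ ih =>
    obtain ⟨x, y, z, x', y', z', h⟩ := ih
    exact ⟨y, x, z, y', x', z', by simpa only [minor, eval_swapXY] using h⟩
  | swapYZ _ ih =>
    obtain ⟨x, y, z, x', y', z', h⟩ := ih
    exact ⟨x, z, y, x', z', y', by simpa only [minor, eval_swapYZ] using h⟩
  | negX _ ih =>
    obtain ⟨x, y, z, x', y', z', h⟩ := ih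
    refine ⟨-x, y, z, -x', y', z', ?_⟩
    simpa only [minor, eval_negX, neg_neg, neg_add] using h
  | shear _ ih =>
    obtain ⟨x, y, z, x', y', z', h⟩ := ih
    refine ⟨x - y, y, z, x' - y', y', z', ?_⟩
    have e : x - y + (x' - y') + (y + y') = x + x' := by ring
    simpa only [minor, eval_shear, sub_add_cancel, e] using h

end Equivalent

/-! ### Minkowski reduction -/

/-- Minkowski-reduced forms, without a sign normalisation. -/
structure Reduced (f : TernaryForm) : Prop where
  a_pos : 0 < f.a
  hab : f.a ≤ f.b
  hbc : f.b ≤ f.c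
  t_le : |f.t| ≤ f.a
  s_le : |f.s| ≤ f.a
  r_le : |f.r| ≤ f.b
  sum₁ : 0 ≤ f.a + f.b + f.t + f.s + f.r
  sum₂ : 0 ≤ f.a + f.b + f.t - f.s - f.r
  sum₃ : 0 ≤ f.a + f.b - f.t + f.s - f.r
  sum₄ : 0 ≤ f.a + f.b - f.t - f.s + f.r

lemma PosDef.a_pos {f : TernaryForm} (hf : f.PosDef) : 0 < f.a := by
  simpa [eval] using hf 1 0 0 (by simp)

lemma PosDef.b_pos {f : TernaryForm} (hf : f.PosDef) : 0 < f.b := by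
  simpa [eval] using hf 0 1 0 (by simp)

lemma PosDef.c_pos {f : TernaryForm} (hf : f.PosDef) : 0 < f.c := by
  simpa [eval] using hf 0 0 1 (by simp)

lemma Equivalent.exists_sorted {f g : TernaryForm} (h : Equivalent f g) :
    ∃ g', Equivalent f g' ∧ g'.a ≤ g'.b ∧ g'.b ≤ g'.c ∧ g'.a + g'.b + g'.c = g.a + g.b + g.c := by
  have h₁ := h.swapXY
  have h₂ := h.swapYZ
  have h₃ := h.swapXY.swapYZ
  have h₄ := h.swapYZ.swapXY
  have h₅ := h.swapXY.swapYZ.swapXY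
  rcases le_total g.a g.b with hab | hab <;> rcases le_total g.b g.c with hbc | hbc <;>
    rcases le_total g.a g.c with hac | hac
  all_goals first
    | exact ⟨_, h, by assumption, by assumption, rfl⟩
    | exact ⟨_, h₁, by assumption, by assumption, by simp only [TernaryForm.swapXY]; ring⟩
    | exact ⟨_, h₂, by assumption, by assumption, by simp only [TernaryForm.swapYZ]; ring⟩
    | exact ⟨_, h₃, by assumption, by assumption, by
        simp only [TernaryForm.swapXY, TernaryForm.swapYZ]; ring⟩
    | exact ⟨_, h₄, by assumption, by assumption, by
        simp only [TernaryForm.swapXY, TernaryForm.swapYZ]; ring⟩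
    | exact ⟨_, h₅, by assumption, by assumption, by
        simp only [TernaryForm.swapXY, TernaryForm.swapYZ]; ring⟩

/-- A form minimising `a + b + c` in its class is reduced once sorted: each inequality says that one
elementary change of basis does not lower this sum. -/
theorem PosDef.exists_reduced {f : TernaryForm} (hf : f.PosDef) :
    ∃ g, Equivalent f g ∧ g.Reduced := by
  classical
  have hex : ∃ m : ℕ, ∃ g, Equivalent f g ∧ g.a + g.b + g.c = m := by
    have := hf.a_pos
    have := hf.b_pos
    have := hf.c_pos
    exact ⟨(f.a + f.b + f.c).toNat, f, .refl, by omega⟩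
  obtain ⟨g₀, hg₀, hs₀⟩ := Nat.find_spec hex
  obtain ⟨g, hg, hab, hbc, hs⟩ := hg₀.exists_sorted
  have hmin : ∀ k, Equivalent f k → g.a + g.b + g.c ≤ k.a + k.b + k.c := by
    intro k hk
    have hk' := hk.posDef hf
    have := hk'.a_pos
    have := hk'.b_pos
    have := hk'.c_pos
    have := Nat.find_min' hex ⟨k, hk, (Int.toNat_of_nonneg (by omega)).symm⟩
    omega
  have t₁ := hmin _ hg.shear
  have t₂ := hmin _ hg.negX.shear
  have s₁ := hmin _ hg.swapYZ.shear
  have s₂ := hmin _ hg.negX.swapYZ.shear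
  have r₁ := hmin _ hg.swapXY.swapYZ.shear
  have r₂ := hmin _ hg.swapXY.negX.swapYZ.shear
  -- These chains replace the third basis vector by `e₃ ± e₁ ± e₂`, so that the value of the form at
  -- `(±1, ±1, 1)` is at least `c`.
  have u₁ := hmin _ hg.swapYZ.shear.swapYZ.swapXY.swapYZ.shear
  have u₂ := hmin _ hg.negX.swapYZ.shear.swapYZ.swapXY.swapYZ.shear
  have u₃ := hmin _ hg.swapYZ.shear.swapYZ.swapXY.negX.swapYZ.shear
  have u₄ := hmin _ hg.negX.swapYZ.shear.swapYZ.swapXY.negX.swapYZ.shear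
  simp only [swapXY, swapYZ, negX, shear] at t₁ t₂ s₁ s₂ r₁ r₂ u₁ u₂ u₃ u₄
  refine ⟨g, hg, (hg.posDef hf).a_pos, hab, hbc, abs_le.2 ⟨?_, ?_⟩, abs_le.2 ⟨?_, ?_⟩,
    abs_le.2 ⟨?_, ?_⟩, ?_, ?_, ?_, ?_⟩ <;> linarith

/-! ### The determinant bound for reduced forms -/

/-- The difference of the two sides is affine in `c` with slope `2ab - t² ≥ 0`, so `c = b` is the
worst case; there it is concave in `r`, so the endpoints `r = 0` and `r = b` suffice. -/
lemma two_mul_le_of_same_sign {a b c r s t : ℤ} (ha : 0 < a) (hab : a ≤ b) (hbc : b ≤ c)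
    (hr : 0 ≤ r) (hs : 0 ≤ s) (ht : 0 ≤ t) (hrb : r ≤ b) (hsa : s ≤ a) (hta : t ≤ a) :
    2 * a * b * c ≤ 4 * a * b * c + r * s * t - a * r ^ 2 - b * s ^ 2 - c * t ^ 2 := by
  have hb : 0 < b := by linarith
  have h₁ : 0 ≤ (c - b) * (2 * a * b - t ^ 2) :=
    mul_nonneg (by linarith) (by nlinarith)
  have h₀ : 0 ≤ 2 * a * b ^ 2 - b * s ^ 2 - b * t ^ 2 := by
    have : s ^ 2 + t ^ 2 ≤ 2 * a * b := by nlinarith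
    nlinarith
  have h₂ : 0 ≤ b * (a * b + s * t - s ^ 2 - t ^ 2) := by
    refine mul_nonneg hb.le ?_
    rcases le_total s t with h | h <;> nlinarith
  have h₃ : 0 ≤ b * (2 * a * b ^ 2 + r * s * t - a * r ^ 2 - b * s ^ 2 - b * t ^ 2) := by
    -- Interpolation between `r = 0` and `r = b`; the last term is the concavity surplus.
    have e : b * (2 * a * b ^ 2 + r * s * t - a * r ^ 2 - b * s ^ 2 - b * t ^ 2) =
        (b - r) * (2 * a * b ^ 2 - b * s ^ 2 - b * t ^ 2) +
          r * (b * (a * b + s * t - s ^ 2 - t ^ 2)) + a * b * (r * (b - r)) := by ring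
    rw [e]
    have := sub_nonneg.2 hrb
    positivity
  have h₄ := nonneg_of_mul_nonneg_right h₃ hb
  linarith

/-- Again `c = b` is the worst case. The difference now decreases in `r`, so it is tested at the
largest admissible `r`, the smaller of `b` and `a + b - s - t`. -/
lemma two_mul_le_of_opposite_sign {a b c r s t : ℤ} (ha : 0 < a) (hab : a ≤ b) (hbc : b ≤ c)
    (hr : 0 ≤ r) (hs : 0 ≤ s) (ht : 0 ≤ t) (hrb : r ≤ b) (hsa : s ≤ a) (hta : t ≤ a)
    (hsum : r + s + t ≤ a + b) :
    2 * a * b * c ≤ 4 * a * b * c - r * s * t - a * r ^ 2 - b * s ^ 2 - c * t ^ 2 := by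
  have hb : 0 < b := by linarith
  have h₁ : 0 ≤ (c - b) * (2 * a * b - t ^ 2) :=
    mul_nonneg (by linarith) (by nlinarith)
  have key : ∀ R : ℤ, 0 ≤ R → r ≤ R →
      r * s * t + a * r ^ 2 ≤ R * s * t + a * R ^ 2 := by
    intro R hR hrR
    have := mul_nonneg (sub_nonneg.2 hrR) (mul_nonneg hs ht)
    have := mul_nonneg ha.le (mul_nonneg (sub_nonneg.2 hrR) (add_nonneg hR hr))
    nlinarith
  have h₂ : 0 ≤ 2 * a * b ^ 2 - r * s * t - a * r ^ 2 - b * s ^ 2 - b * t ^ 2 := by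
    rcases le_total (s + t) a with h | h
    · have h₃ := key b hb.le hrb
      have h₄ : 0 ≤ b * (a * b - s * t - s ^ 2 - t ^ 2) := by
        refine mul_nonneg hb.le ?_
        nlinarith [mul_nonneg hs ht]
      linarith
    · have h₃ := key (a + b - s - t) (by linarith) (by linarith)
      have h₄ : 0 ≤ (2 * b + s + t - a) * ((a - s) * (a - t)) :=
        mul_nonneg (by linarith) (mul_nonneg (by linarith) (by linarith))
      have h₅ : 0 ≤ a * b * (b - a) := by
        have := sub_nonneg.2 hab
        positivity
      have h₆ : 0 ≤ b * ((s + t - a) * (2 * a - s - t)) :=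
        mul_nonneg hb.le (mul_nonneg (by linarith) (by linarith))
      nlinarith
  linarith

lemma Reduced.two_mul_le_disc {f : TernaryForm} (hf : f.Reduced) :
    2 * f.a * f.b * f.c ≤ f.disc := by
  obtain ⟨ha, hab, hbc, ht, hs, hr, h₁, h₂, h₃, h₄⟩ := hf
  unfold disc
  generalize f.a = a at *
  generalize f.b = b at *
  generalize f.c = c at *
  generalize f.r = r at *
  generalize f.s = s at *
  generalize f.t = t at *
  rw [abs_le] at ht hs hr
  rcases le_total 0 r with r0 | r0 <;> rcases le_total 0 s with s0 | s0 <;>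
    rcases le_total 0 t with t0 | t0
  · linarith [two_mul_le_of_same_sign ha hab hbc r0 s0 t0 hr.2 hs.2 ht.2]
  · linarith [two_mul_le_of_opposite_sign ha hab hbc r0 s0 (neg_nonneg.2 t0) hr.2 hs.2
      (by linarith) (by linarith)]
  · linarith [two_mul_le_of_opposite_sign ha hab hbc r0 (neg_nonneg.2 s0) t0 hr.2 (by linarith)
      ht.2 (by linarith)]
  · linarith [two_mul_le_of_same_sign ha hab hbc r0 (neg_nonneg.2 s0) (neg_nonneg.2 t0) hr.2
      (by linarith) (by linarith)]
  · linarith [two_mul_le_of_opposite_sign ha hab hbc (neg_nonneg.2 r0) s0 t0 (by linarith) hs.2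
      ht.2 (by linarith)]
  · linarith [two_mul_le_of_same_sign ha hab hbc (neg_nonneg.2 r0) s0 (neg_nonneg.2 t0)
      (by linarith) hs.2 (by linarith)]
  · linarith [two_mul_le_of_same_sign ha hab hbc (neg_nonneg.2 r0) (neg_nonneg.2 s0) t0
      (by linarith) (by linarith) ht.2]
  · linarith [two_mul_le_of_opposite_sign ha hab hbc (neg_nonneg.2 r0) (neg_nonneg.2 s0)
      (neg_nonneg.2 t0) (by linarith) (by linarith) (by linarith) (by linarith)]

lemma Reduced.small {f : TernaryForm} (hf : f.Reduced) (hd : f.disc ≤ 7) :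
    f.a = 1 ∧ f.b = 1 ∧ 1 ≤ f.c ∧ f.c ≤ 3 := by
  have h := hf.two_mul_le_disc
  have h₁ := hf.a_pos
  have h₂ := hf.hab
  have h₃ := hf.hbc
  have hb : f.b < 2 := by
    by_contra! hb
    have : 2 * 2 ≤ f.b * f.c := mul_le_mul hb (by omega) (by omega) (by omega)
    nlinarith
  have hb' : f.b = 1 := by omega
  have ha' : f.a = 1 := by omega
  rw [ha', hb'] at h
  exact ⟨ha', hb', by omega, by omega⟩

lemma Reduced.coeff_cases {f : TernaryForm} (hf : f.Reduced) (hd : f.disc ≤ 7) :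
    (f.r = -1 ∨ f.r = 0 ∨ f.r = 1) ∧ (f.s = -1 ∨ f.s = 0 ∨ f.s = 1) ∧
      (f.t = -1 ∨ f.t = 0 ∨ f.t = 1) := by
  obtain ⟨ha, hb, -, -⟩ := hf.small hd
  have hr := abs_le.1 hf.r_le
  have hs := abs_le.1 hf.s_le
  have ht := abs_le.1 hf.t_le
  rw [hb] at hr
  rw [ha] at hs ht
  omega

/-! ### Forms of small discriminant -/

lemma PosDef.exists_small {f : TernaryForm} (hf : f.PosDef) (hd : f.disc ≤ 7) :
    ∃ c r s t : ℤ, (c = 1 ∨ c = 2 ∨ c = 3) ∧ (r = -1 ∨ r = 0 ∨ r = 1) ∧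
      (s = -1 ∨ s = 0 ∨ s = 1) ∧ (t = -1 ∨ t = 0 ∨ t = 1) ∧
      4 * c + r * s * t - r ^ 2 - s ^ 2 - c * t ^ 2 = f.disc ∧
      0 ≤ 2 + t + s + r ∧ 0 ≤ 2 + t - s - r ∧ 0 ≤ 2 - t + s - r ∧ 0 ≤ 2 - t - s + r ∧
      Equivalent f ⟨1, 1, c, r, s, t⟩ := by
  obtain ⟨g, hg, hr⟩ := hf.exists_reduced
  have hd' : g.disc ≤ 7 := hg.disc_eq ▸ hd
  obtain ⟨ha, hb, hc₁, hc₂⟩ := hr.small hd'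
  obtain ⟨h₁, h₂, h₃⟩ := hr.coeff_cases hd'
  have e : (⟨1, 1, g.c, g.r, g.s, g.t⟩ : TernaryForm) = g := by
    ext <;> simp [ha, hb]
  have h₄ := hr.sum₁
  have h₅ := hr.sum₂
  have h₆ := hr.sum₃
  have h₇ := hr.sum₄
  rw [ha, hb] at h₄ h₅ h₆ h₇
  refine ⟨g.c, g.r, g.s, g.t, by omega, h₁, h₂, h₃, ?_, by omega, by omega, by omega, by omega,
    e ▸ hg⟩
  rw [← hg.disc_eq, disc, ha, hb]
  ring

/-- The surviving reduced forms have `c = 1` and either exactly two nonzero cross terms or `rst =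
1`; doubling each gives an explicit sum of three squares. -/
theorem PosDef.sum_three_squares_of_disc_two {f : TernaryForm} (hf : f.PosDef) (hd : f.disc = 2)
    {n : ℤ} (hn : f.Represents n) :
    ∃ x y z : ℤ, 2 * n = x ^ 2 + y ^ 2 + z ^ 2 := by
  obtain ⟨c, r, s, t, hc, hr, hs, ht, hD, -, -, -, -, hE⟩ := hf.exists_small (by omega)
  obtain ⟨x, y, z, h⟩ := hE.represents hn
  rw [hd] at hD
  simp only [eval] at h
  clear hE
  rcases hc with hc | hc | hc <;> rcases hr with hr | hr | hr <;>
    rcases hs with hs | hs | hs <;> rcases ht with ht | ht | ht <;>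
    first
    | (exfalso; subst hc hr hs ht; revert hD; norm_num; done)
    | (refine ⟨x + t * y, x + s * z, y + r * z, ?_⟩;
        subst hc hr hs ht; linear_combination (-2) * h)
    | (refine ⟨x + t * y + s * z, x, t * y - s * z, ?_⟩;
        subst hc hr hs ht; linear_combination (-2) * h)
    | (refine ⟨y + t * x + r * z, y, t * x - r * z, ?_⟩;
        subst hc hr hs ht; linear_combination (-2) * h)
    | (refine ⟨z + s * x + r * y, z, s * x - r * y, ?_⟩;
        subst hc hr hs ht; linear_combination (-2) * h)

theorem PosDef.represents_of_disc_three {f : TernaryForm} (hf : f.PosDef) (hd : f.disc = 3)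
    {n : ℤ} (hn : f.Represents n) :
    ∃ x y z : ℤ, n = x ^ 2 + x * y + y ^ 2 + z ^ 2 := by
  obtain ⟨c, r, s, t, hc, hr, hs, ht, hD, h₁, h₂, h₃, h₄, hE⟩ := hf.exists_small (by omega)
  obtain ⟨x, y, z, h⟩ := hE.represents hn
  rw [hd] at hD
  simp only [eval] at h
  clear hE
  rcases hc with hc | hc | hc <;> rcases hr with hr | hr | hr <;>
    rcases hs with hs | hs | hs <;> rcases ht with ht | ht | ht <;>
    first
    | (exfalso; subst hc hr hs ht; revert hD; norm_num; done)
    -- The case `c = 2`, `rst = -1` also has discriminant 3; only the four sum inequalities exclude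
    -- it.
    | (exfalso; subst hc hr hs ht; revert h₁ h₂ h₃ h₄; norm_num; done)
    | (refine ⟨x, t * y, z, ?_⟩; subst hc hr hs ht; linear_combination (-1) * h)
    | (refine ⟨x, s * z, y, ?_⟩; subst hc hr hs ht; linear_combination (-1) * h)
    | (refine ⟨y, r * z, x, ?_⟩; subst hc hr hs ht; linear_combination (-1) * h)

theorem PosDef.represents_of_disc_five {f : TernaryForm} (hf : f.PosDef) (hd : f.disc = 5)
    {n : ℤ} (hn : f.Represents n) :
    ∃ x y z : ℤ, n = x ^ 2 + y ^ 2 + 2 * z ^ 2 + x * y + x * z := by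
  obtain ⟨c, r, s, t, hc, hr, hs, ht, hD, -, -, -, -, hE⟩ := hf.exists_small (by omega)
  obtain ⟨x, y, z, h⟩ := hE.represents hn
  rw [hd] at hD
  simp only [eval] at h
  clear hE
  rcases hc with hc | hc | hc <;> rcases hr with hr | hr | hr <;>
    rcases hs with hs | hs | hs <;> rcases ht with ht | ht | ht <;>
    first
    | (exfalso; subst hc hr hs ht; revert hD; norm_num; done)
    | (refine ⟨x, t * y, s * z, ?_⟩; subst hc hr hs ht; linear_combination (-1) * h)
    | (refine ⟨y, t * x, r * z, ?_⟩; subst hc hr hs ht; linear_combination (-1) * h)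
    | (refine ⟨x + t * y, -t * y, s * z, ?_⟩; subst hc hr hs ht; linear_combination (-1) * h)

/-- Modulo `3` the form `x² ± x y + y² + 2 z²` is a hyperbolic plane plus its radical, so its
binary minors are `0` or `-1`. -/
lemma not_hasMinorOne {e : ℤ} (he : e = 1 ∨ e = -1) : ¬HasMinorOne ⟨1, 1, 2, 0, 0, e⟩ := by
  rintro ⟨x, y, z, x', y', z', k, hk⟩
  have hsq : ∀ p q : ℤ, 3 * p - q ^ 2 ≠ 1 := by
    intro p q h
    have h3 : q % 3 = 0 ∨ q % 3 = 1 ∨ q % 3 = 2 := by omega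
    have h4 := congrArg (· % 3) h
    rcases h3 with h3 | h3 | h3 <;> simp [pow_two, Int.sub_emod, Int.mul_emod, h3] at h4
  -- The form equals `X² - z² + 3u`, so modulo 3 the minor is `-4(X z' - X' z)²`, which cannot be 1
  -- because `-1` is not a square modulo 3.
  obtain ⟨X, hX⟩ : ∃ X, X = x - e * y := ⟨_, rfl⟩
  obtain ⟨X', hX'⟩ : ∃ X', X' = x' - e * y' := ⟨_, rfl⟩
  obtain ⟨u, hu⟩ : ∃ u, u = e * x * y + z ^ 2 := ⟨_, rfl⟩
  obtain ⟨u', hu'⟩ : ∃ u', u' = e * x' * y' + z' ^ 2 := ⟨_, rfl⟩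
  obtain ⟨v, hv⟩ : ∃ v, v = e * (x * y' + x' * y) + 2 * z * z' := ⟨_, rfl⟩
  simp only [minor, eval] at hk
  refine hsq (4 * (u * (X' ^ 2 - z' ^ 2) + u' * (X ^ 2 - z ^ 2) + 3 * u * u') -
    4 * (X * X' - z * z') * v - 3 * v ^ 2 - k) (2 * (X * z' - X' * z)) ?_
  subst hX hX' hu hu' hv
  rcases he with rfl | rfl <;> linear_combination hk

theorem PosDef.represents_of_disc_six {f : TernaryForm} (hf : f.PosDef) (hd : f.disc = 6)
    (hm : f.HasMinorOne) {n : ℤ} (hn : f.Represents n) :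
    ∃ x y z : ℤ, n = x ^ 2 + y ^ 2 + 2 * z ^ 2 + x * z + y * z := by
  obtain ⟨c, r, s, t, hc, hr, hs, ht, hD, h₁, h₂, h₃, h₄, hE⟩ := hf.exists_small (by omega)
  obtain ⟨x, y, z, h⟩ := hE.represents hn
  have hm' := hE.hasMinorOne hm
  rw [hd] at hD
  simp only [eval] at h
  clear hE
  rcases hc with hc | hc | hc <;> rcases hr with hr | hr | hr <;>
    rcases hs with hs | hs | hs <;> rcases ht with ht | ht | ht <;>
    first
    | (exfalso; subst hc hr hs ht; revert hD; norm_num; done)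
    | (exfalso; subst hc hr hs ht; revert h₁ h₂ h₃ h₄; norm_num; done)
    | (refine ⟨s * x, r * y, z, ?_⟩; subst hc hr hs ht; linear_combination (-1) * h)
    | (subst hc hr hs ht; exact absurd hm' (not_hasMinorOne (by norm_num)))

end TernaryForm

/-! ### Forms with prescribed discriminant and value -/

namespace TernaryForm

/-- If `-D` is a square modulo `b`, there is a positive definite form of discriminant
`4 c D - b s²` with middle coefficient `b`, last coefficient `c` and first binary minor `4 D`. -/
theorem exists_posDef {b c s D τ d : ℤ} (hb : 0 < b) (hD : 0 < D) (hd : 0 < d)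
    (hτ : b ∣ τ ^ 2 + D) (hdisc : 4 * c * D - b * s ^ 2 = d) :
    ∃ f : TernaryForm, f.PosDef ∧ f.disc = d ∧ f.Represents c ∧
      (3 ∣ D - 1 → f.HasMinorOne) := by
  obtain ⟨a, ha⟩ := hτ
  refine ⟨⟨a, b, c, 0, s, 2 * τ⟩, ?_, ?_, ⟨0, 0, 1, by simp [eval]⟩, ?_⟩
  · intro x y z hxyz
    -- Successive completion of squares, using `ab = τ² + D`.
    have e : (4 * b * D) * eval ⟨a, b, c, 0, s, 2 * τ⟩ x y z =
        4 * D * (b * y + τ * x) ^ 2 + (2 * D * x + b * s * z) ^ 2 + b * d * z ^ 2 := by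
      rw [← hdisc]
      simp only [eval]
      linear_combination (-(4 * D * x ^ 2)) * ha
    refine pos_of_mul_pos_right (a := 4 * b * D) ?_ (by positivity)
    rw [e]
    rcases eq_or_ne z 0 with rfl | hz
    · rcases eq_or_ne x 0 with rfl | hx
      · have hy : y ≠ 0 := by simpa using hxyz
        have : 0 < 4 * D * (b * y) ^ 2 := by positivity
        simpa using this
      · have : 0 < (2 * D * x) ^ 2 := by positivity
        have : 0 ≤ 4 * D * (b * y + τ * x) ^ 2 := by positivity
        simp only [mul_zero, add_zero]
        nlinarith
    · positivity
  · simp only [disc]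
    linear_combination hdisc - 4 * c * ha
  · rintro ⟨k, hk⟩
    refine ⟨1, 0, 0, 0, 1, 0, D + k, ?_⟩
    simp only [minor, eval]
    linear_combination -4 * ha + hk

end TernaryForm

/-! ### Primes and quadratic residues -/

theorem exists_prime_eq_mul_add {q : ℕ} {A : ℤ} (hq : q ≠ 0) (h : IsCoprime A q) :
    ∃ k p : ℕ, p.Prime ∧ (p : ℤ) = q * k + A := by
  -- Asking for `p > A` forces the multiplier `k` to be nonnegative.
  obtain ⟨p, hp, hprime, hmod⟩ := Nat.forall_exists_prime_gt_and_zmodEq A.toNat hq h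
  obtain ⟨k, hk⟩ := hmod.symm.dvd
  have hk0 : 0 ≤ k := by
    by_contra! hk0
    have : (q : ℤ) * k < 0 := mul_neg_of_pos_of_neg (by positivity) hk0
    omega
  lift k to ℕ using hk0
  exact ⟨k, p, hprime, by linarith⟩

open NumberTheorySymbols

lemma jacobiSym_neg_one_of_one_mod_four {n : ℕ} (hn : n % 4 = 1) : J(-1 | n) = 1 := by
  rw [jacobiSym.at_neg_one (Nat.odd_iff.2 (by omega)), ZMod.χ₄_nat_one_mod_four hn]

lemma jacobiSym_neg_one_of_three_mod_four {n : ℕ} (hn : n % 4 = 3) : J(-1 | n) = -1 := by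
  rw [jacobiSym.at_neg_one (Nat.odd_iff.2 (by omega)), ZMod.χ₄_nat_three_mod_four hn]

lemma jacobiSym_congr {a a' : ℤ} {n : ℕ} (h : (n : ℤ) ∣ a' - a) : J(a | n) = J(a' | n) :=
  jacobiSym.mod_left' (Int.modEq_iff_dvd.2 h)

lemma jacobiSym_neg_left (a : ℤ) (n : ℕ) : J(-a | n) = J(-1 | n) * J(a | n) := by
  rw [← jacobiSym.mul_left, neg_one_mul]

lemma jacobiSym_eq_one_of_mod_three {n : ℕ} (hn : n % 3 = 1) : J(n | 3) = 1 := by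
  rw [jacobiSym.mod_left' (a₂ := 1) (by omega), jacobiSym.one_left]

/-- If `-D` is a quadratic residue modulo the odd prime `p`, it is one modulo `2 p`. -/
theorem exists_two_mul_dvd_sq_add {p : ℕ} (hp : p.Prime) (hp2 : p % 2 = 1) {D : ℤ}
    (h : J(-D | p) = 1) : ∃ τ : ℤ, 2 * (p : ℤ) ∣ τ ^ 2 + D := by
  have := Fact.mk hp
  obtain ⟨u, hu⟩ := ZMod.isSquare_of_jacobiSym_eq_one h
  obtain ⟨v, rfl⟩ := ZMod.intCast_surjective u
  have hv : (p : ℤ) ∣ v ^ 2 + D := by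
    rw [← ZMod.intCast_zmod_eq_zero_iff_dvd]
    push_cast at hu ⊢
    linear_combination -hu
  have hcop : IsCoprime (2 : ℤ) p := by
    rw [Int.isCoprime_iff_gcd_eq_one]
    exact_mod_cast (Nat.coprime_two_left.2 (Nat.odd_iff.2 hp2))
  rcases Int.even_or_odd (v ^ 2 + D) with he | ho
  · exact ⟨v, hcop.mul_dvd he.two_dvd hv⟩
  · refine ⟨v + p, hcop.mul_dvd ?_ ?_⟩
    · have : Odd ((p : ℤ) * (2 * v + p)) := by
        have hp' : Odd (p : ℤ) := by exact_mod_cast Nat.odd_iff.2 hp2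
        exact hp'.mul ((even_two_mul v).add_odd hp')
      have h2 := (ho.add_odd this).two_dvd
      convert h2 using 1
      ring
    · have := dvd_add hv (dvd_mul_right (p : ℤ) (2 * v + p))
      convert this using 1
      ring

lemma jacobiSym_neg_of_one_mod_four {D p : ℕ} (hp : p % 4 = 1) (hD : D % 2 = 1) :
    J(-(D : ℤ) | p) = J(p | D) := by
  rw [jacobiSym_neg_left, jacobiSym_neg_one_of_one_mod_four hp, one_mul,
    jacobiSym.quadratic_reciprocity_one_mod_four hp (Nat.odd_iff.2 hD)]

lemma isCoprime_two_right {a : ℤ} (h : a % 2 = 1) : IsCoprime a 2 :=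
  ⟨1, -(a / 2), by omega⟩

lemma isCoprime_three_right {a : ℤ} (h : a % 3 ≠ 0) : IsCoprime a 3 := by
  rcases (by omega : a % 3 = 1 ∨ a % 3 = 2) with h | h
  · exact ⟨1, -(a / 3), by omega⟩
  · exact ⟨-1, a / 3 + 1, by omega⟩

/-! ### Representation theorems -/

/-- Here `D = 4k + 1`, `b = 2p` and `p = 2nD - 1`; since `p ≡ -1` modulo `D` and `D ≡ 1` modulo 4,
reciprocity gives the symbol 1. -/
theorem sum_three_squares_two_mul_odd {n : ℕ} (hn : n % 2 = 1) :
    ∃ x y z : ℤ, 2 * (n : ℤ) = x ^ 2 + y ^ 2 + z ^ 2 := by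
  have h2 : IsCoprime (2 * n - 1 : ℤ) 2 := isCoprime_two_right (by omega)
  have hcop : IsCoprime (2 * n - 1 : ℤ) (2 ^ 3 * (n : ℤ)) := by
    exact h2.pow_right.mul_right ⟨-1, 2, by ring⟩
  obtain ⟨k, p, hp, hpk⟩ := exists_prime_eq_mul_add (q := 8 * n) (by omega)
    (by push_cast; exact hcop)
  push_cast at hpk
  have hp4 : p % 4 = 1 := by
    have : (p : ℤ) = 4 * (2 * (n * k)) + (2 * n - 1) := by rw [hpk]; ring
    omega
  have hJ : J(-((4 * k + 1 : ℕ) : ℤ) | p) = 1 := by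
    rw [jacobiSym_neg_of_one_mod_four hp4 (by omega), jacobiSym_congr (a' := -1),
      jacobiSym_neg_one_of_one_mod_four (by omega)]
    exact ⟨-(2 * n), by push_cast; linear_combination -hpk⟩
  obtain ⟨τ, hτ⟩ := exists_two_mul_dvd_sq_add hp (by omega) hJ
  obtain ⟨f, hf, hd, hr, -⟩ := TernaryForm.exists_posDef (b := 2 * p) (c := n) (s := 1) (d := 2)
    (by have := hp.pos; omega) (by positivity) (by norm_num) hτ
    (by push_cast; linear_combination (-2) * hpk)
  exact hf.sum_three_squares_of_disc_two hd hr

/-- Here `D = 12k + 1` and `p = 4nD - 3`, so the symbol reduces to that of `-3` over `D`. -/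
theorem exists_sq_add_mul_add_sq_add_sq {n : ℕ} (hn : n % 3 ≠ 0) :
    ∃ x y z : ℤ, (n : ℤ) = x ^ 2 + x * y + y ^ 2 + z ^ 2 := by
  have h3 : IsCoprime (n : ℤ) 3 := isCoprime_three_right (by omega)
  have h2 : IsCoprime (4 * n - 3 : ℤ) 2 := isCoprime_two_right (by omega)
  have h3' : IsCoprime (4 * n - 3 : ℤ) 3 := isCoprime_three_right (by omega)
  have hcop : IsCoprime (4 * n - 3 : ℤ) (2 ^ 4 * 3 * (n : ℤ)) := by
    refine (h2.pow_right.mul_right h3').mul_right ?_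
    obtain ⟨u, v, h⟩ := h3
    exact ⟨-v, u + 4 * v, by linear_combination h⟩
  obtain ⟨k, p, hp, hpk⟩ := exists_prime_eq_mul_add (q := 48 * n) (by omega)
    (by push_cast; exact hcop)
  push_cast at hpk
  have hp4 : p % 4 = 1 := by
    have : (p : ℤ) = 4 * (12 * (n * k)) + (4 * n - 3) := by rw [hpk]; ring
    omega
  have hJ : J(-((12 * k + 1 : ℕ) : ℤ) | p) = 1 := by
    rw [jacobiSym_neg_of_one_mod_four hp4 (by omega), jacobiSym_congr (a' := -((3 : ℕ) : ℤ)),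
      jacobiSym_neg_left, jacobiSym_neg_one_of_one_mod_four (by omega), one_mul,
      jacobiSym.quadratic_reciprocity_one_mod_four' (by decide) (by omega),
      jacobiSym_eq_one_of_mod_three (by omega)]
    exact ⟨-(4 * n), by push_cast; linear_combination -hpk⟩
  obtain ⟨τ, hτ⟩ := exists_two_mul_dvd_sq_add hp (by omega) hJ
  obtain ⟨f, hf, hd, hr, -⟩ := TernaryForm.exists_posDef (b := p) (c := n) (s := 1) (d := 3)
    (by have := hp.pos; omega) (by positivity) (by norm_num) (dvd_of_mul_left_dvd hτ)
    (by push_cast; linear_combination (-1) * hpk)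
  exact hf.represents_of_disc_three hd hr

/-- With `s = 3` and target `3n`, the equation becomes `3p = 4nD - 1`, where `D = 12k + 1`;
integrality of `p` is why `n ≡ 1` modulo 3. -/
theorem exists_three_mul_eq_sq_add_mul_add_sq_add_sq {n : ℕ} (hn : n % 3 = 1) :
    ∃ x y z : ℤ, 3 * (n : ℤ) = x ^ 2 + x * y + y ^ 2 + z ^ 2 := by
  obtain ⟨j, rfl⟩ : ∃ j, n = 3 * j + 1 := ⟨n / 3, by omega⟩
  have h2 : IsCoprime (4 * j + 1 : ℤ) 2 := isCoprime_two_right (by omega)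
  have hcop : IsCoprime (4 * j + 1 : ℤ) (2 ^ 4 * (3 * j + 1)) := by
    exact h2.pow_right.mul_right ⟨-3, 4, by ring⟩
  obtain ⟨k, p, hp, hpk⟩ := exists_prime_eq_mul_add (q := 16 * (3 * j + 1)) (by omega)
    (by push_cast; exact hcop)
  push_cast at hpk
  have hp4 : p % 4 = 1 := by
    have : (p : ℤ) = 4 * (4 * (3 * j + 1) * k + j) + 1 := by rw [hpk]; ring
    omega
  have hJ : J(-((12 * k + 1 : ℕ) : ℤ) | p) = 1 := by
    have h3 : J(((3 : ℕ) : ℤ) | 12 * k + 1) = 1 := by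
      rw [jacobiSym.quadratic_reciprocity_one_mod_four' (by decide) (by omega),
        jacobiSym_eq_one_of_mod_three (by omega)]
    have h3p : J(((3 : ℕ) : ℤ) | 12 * k + 1) * J((p : ℤ) | 12 * k + 1) = 1 := by
      rw [← jacobiSym.mul_left, jacobiSym_congr (a' := -1),
        jacobiSym_neg_one_of_one_mod_four (by omega)]
      exact ⟨-(4 * (3 * j + 1)), by push_cast; linear_combination (-3) * hpk⟩
    rwa [h3, one_mul, ← jacobiSym_neg_of_one_mod_four hp4 (by omega)] at h3p
  obtain ⟨τ, hτ⟩ := exists_two_mul_dvd_sq_add hp (by omega) hJ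
  obtain ⟨f, hf, hd, hr, -⟩ := TernaryForm.exists_posDef (b := p) (c := 3 * (3 * j + 1 : ℕ))
    (s := 3) (d := 3) (by have := hp.pos; omega) (by positivity) (by norm_num)
    (dvd_of_mul_left_dvd hτ) (by push_cast; linear_combination (-9) * hpk)
  exact hf.represents_of_disc_three hd hr

/-- Here `D = 12k + 7` and `p = 2nD - 3`. Besides giving the residue symbol, `D ≡ 1` modulo 3
supplies the minor that selects the class. -/
theorem exists_of_disc_six {n : ℕ} (hn : n % 6 = 1) :
    ∃ x y z : ℤ, (n : ℤ) = x ^ 2 + y ^ 2 + 2 * z ^ 2 + x * z + y * z := by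
  have h3 : IsCoprime (n : ℤ) 3 := isCoprime_three_right (by omega)
  have h2 : IsCoprime (14 * n - 3 : ℤ) 2 := isCoprime_two_right (by omega)
  have h3' : IsCoprime (14 * n - 3 : ℤ) 3 := isCoprime_three_right (by omega)
  have hcop : IsCoprime (14 * n - 3 : ℤ) (2 ^ 3 * 3 * (n : ℤ)) := by
    refine (h2.pow_right.mul_right h3').mul_right ?_
    obtain ⟨u, v, h⟩ := h3
    exact ⟨-v, u + 14 * v, by linear_combination h⟩
  obtain ⟨k, p, hp, hpk⟩ := exists_prime_eq_mul_add (q := 24 * n) (by omega)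
    (by push_cast; exact hcop)
  push_cast at hpk
  have hp4 : p % 4 = 3 := by
    have : (p : ℤ) = 4 * (6 * (n * k)) + (14 * n - 3) := by rw [hpk]; ring
    omega
  have hJ : J(-((12 * k + 7 : ℕ) : ℤ) | p) = 1 := by
    rw [jacobiSym_neg_left, jacobiSym_neg_one_of_three_mod_four hp4,
      jacobiSym.quadratic_reciprocity_three_mod_four (by omega) hp4,
      jacobiSym_congr (a' := -((3 : ℕ) : ℤ)),
      jacobiSym_neg_left, jacobiSym_neg_one_of_three_mod_four (by omega),
      jacobiSym.quadratic_reciprocity_three_mod_four (by decide) (by omega),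
      jacobiSym_eq_one_of_mod_three (by omega)]
    · norm_num
    · exact ⟨-(2 * n), by push_cast; linear_combination -hpk⟩
  obtain ⟨τ, hτ⟩ := exists_two_mul_dvd_sq_add hp (by omega) hJ
  obtain ⟨f, hf, hd, hr, hm⟩ := TernaryForm.exists_posDef (b := 2 * p) (c := n) (s := 1) (d := 6)
    (by have := hp.pos; omega) (by positivity) (by norm_num) hτ
    (by push_cast; linear_combination (-2) * hpk)
  exact hf.represents_of_disc_six hd (hm (by omega)) hr

/-- With `s = 5` and target `5n`, the equation becomes `5p = 4nD - 1`, where `D = 20k + 13`. As 5 is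
a nonresidue symbol over `D`, so is `p`, which cancels the sign from `p ≡ 3` modulo 4. -/
theorem exists_of_disc_five {n : ℕ} (hn : n % 5 = 3) :
    ∃ x y z : ℤ, 5 * (n : ℤ) = x ^ 2 + y ^ 2 + 2 * z ^ 2 + x * y + x * z := by
  obtain ⟨j, rfl⟩ : ∃ j, n = 5 * j + 3 := ⟨n / 5, by omega⟩
  have h2 : IsCoprime (52 * j + 31 : ℤ) 2 := isCoprime_two_right (by omega)
  have hcop : IsCoprime (52 * j + 31 : ℤ) (2 ^ 4 * (5 * j + 3)) := by
    exact h2.pow_right.mul_right ⟨-5, 52, by ring⟩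
  obtain ⟨k, p, hp, hpk⟩ := exists_prime_eq_mul_add (q := 16 * (5 * j + 3)) (by omega)
    (by push_cast; exact hcop)
  push_cast at hpk
  have hp4 : p % 4 = 3 := by
    have : (p : ℤ) = 4 * (4 * (5 * j + 3) * k + 13 * j + 7) + 3 := by rw [hpk]; ring
    omega
  have hJ : J(-((20 * k + 13 : ℕ) : ℤ) | p) = 1 := by
    have h5 : J(((5 : ℕ) : ℤ) | 20 * k + 13) = -1 := by
      rw [jacobiSym.quadratic_reciprocity_one_mod_four (by decide) (Nat.odd_iff.2 (by omega)),
        jacobiSym_congr (a' := 3) ⟨-(4 * k + 2), by push_cast; ring⟩]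
      norm_num
    have h5p : J(((5 : ℕ) : ℤ) | 20 * k + 13) * J((p : ℤ) | 20 * k + 13) = 1 := by
      rw [← jacobiSym.mul_left, jacobiSym_congr (a' := -1),
        jacobiSym_neg_one_of_one_mod_four (by omega)]
      exact ⟨-(4 * (5 * j + 3)), by push_cast; linear_combination (-5) * hpk⟩
    rw [jacobiSym_neg_left, jacobiSym_neg_one_of_three_mod_four hp4,
      jacobiSym.quadratic_reciprocity_one_mod_four (by omega) (Nat.odd_iff.2 (by omega)),
      ← h5, h5p]
  obtain ⟨τ, hτ⟩ := exists_two_mul_dvd_sq_add hp (by omega) hJ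
  obtain ⟨f, hf, hd, hr, -⟩ := TernaryForm.exists_posDef (b := p) (c := 5 * (5 * j + 3 : ℕ))
    (s := 5) (d := 5) (by have := hp.pos; omega) (by positivity) (by norm_num)
    (dvd_of_mul_left_dvd hτ) (by push_cast; linear_combination (-25) * hpk)
  exact hf.represents_of_disc_five hd hr

/-! ### Diagonal ternary forms -/

lemma sq_emod_four (x : ℤ) : x % 2 = 0 ∧ x ^ 2 % 4 = 0 ∨ x % 2 = 1 ∧ x ^ 2 % 8 = 1 := by
  have h : x % 8 = 0 ∨ x % 8 = 1 ∨ x % 8 = 2 ∨ x % 8 = 3 ∨ x % 8 = 4 ∨ x % 8 = 5 ∨ x % 8 = 6 ∨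
    x % 8 = 7 := by omega
  have h2 : x ^ 2 % 8 = (x % 8) * (x % 8) % 8 := by rw [sq, Int.mul_emod]
  rcases h with h | h | h | h | h | h | h | h <;> rw [h] at h2 <;> omega

lemma sq_emod_three (x : ℤ) : x % 3 = 0 ∧ x ^ 2 % 3 = 0 ∨ x % 3 ≠ 0 ∧ x ^ 2 % 3 = 1 := by
  have h : x % 3 = 0 ∨ x % 3 = 1 ∨ x % 3 = 2 := by omega
  have h2 : x ^ 2 % 3 = (x % 3) * (x % 3) % 3 := by rw [sq, Int.mul_emod]
  rcases h with h | h | h <;> rw [h] at h2 <;> omega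

lemma sq_emod_five (x : ℤ) : x % 5 = 0 ∧ x ^ 2 % 5 = 0 ∨
    (x % 5 = 1 ∨ x % 5 = 4) ∧ x ^ 2 % 5 = 1 ∨ (x % 5 = 2 ∨ x % 5 = 3) ∧ x ^ 2 % 5 = 4 := by
  have h : x % 5 = 0 ∨ x % 5 = 1 ∨ x % 5 = 2 ∨ x % 5 = 3 ∨ x % 5 = 4 := by omega
  have h2 : x ^ 2 % 5 = (x % 5) * (x % 5) % 5 := by rw [sq, Int.mul_emod]
  rcases h with h | h | h | h | h <;> rw [h] at h2 <;> omega

theorem exists_sq_add_two_sq_add_four_sq {n : ℕ} (hn : n % 2 = 1) :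
    ∃ x y z : ℤ, (n : ℤ) = x ^ 2 + 2 * y ^ 2 + 4 * z ^ 2 := by
  have key : ∀ a b c : ℤ, 2 * (n : ℤ) = a ^ 2 + b ^ 2 + c ^ 2 → a % 2 = 1 → b % 2 = 1 →
      c % 2 = 0 → ∃ x y z : ℤ, (n : ℤ) = x ^ 2 + 2 * y ^ 2 + 4 * z ^ 2 := by
    intro a b c h ha hb hc
    obtain ⟨p, hp⟩ : ∃ p, a + b = 2 * p := ⟨(a + b) / 2, by omega⟩
    obtain ⟨d, rfl⟩ : ∃ d, c = 2 * d := ⟨c / 2, by omega⟩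
    obtain ⟨q, rfl⟩ : ∃ q, b = p - q := ⟨p - b, by ring⟩
    obtain rfl : a = p + q := by linarith
    have h' : (n : ℤ) = p ^ 2 + q ^ 2 + 2 * d ^ 2 := by linarith
    rcases (by omega : p % 2 = 0 ∨ q % 2 = 0) with hp | hq
    · obtain ⟨e, rfl⟩ : ∃ e, p = 2 * e := ⟨p / 2, by omega⟩
      exact ⟨q, d, e, by linarith⟩
    · obtain ⟨e, rfl⟩ : ∃ e, q = 2 * e := ⟨q / 2, by omega⟩
      exact ⟨p, d, e, by linarith⟩
  obtain ⟨a, b, c, h⟩ := sum_three_squares_two_mul_odd hn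
  rcases sq_emod_four a with ⟨ha, ha'⟩ | ⟨ha, ha'⟩ <;>
    rcases sq_emod_four b with ⟨hb, hb'⟩ | ⟨hb, hb'⟩ <;>
    rcases sq_emod_four c with ⟨hc, hc'⟩ | ⟨hc, hc'⟩
  all_goals first
    | omega
    | exact key a b c h ha hb hc
    | exact key a c b (by linarith) ha hc hb
    | exact key b c a (by linarith) hb hc ha

lemma sq_add_mul_add_sq_eq (a b : ℤ) : ∃ u v : ℤ, a ^ 2 + a * b + b ^ 2 = u ^ 2 + 3 * v ^ 2 := by
  rcases Int.even_or_odd' a with ⟨k, rfl | rfl⟩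
  · exact ⟨b + k, k, by ring⟩
  rcases Int.even_or_odd' b with ⟨l, rfl | rfl⟩
  · exact ⟨2 * k + 1 + l, l, by ring⟩
  · exact ⟨k - l, k + l + 1, by ring⟩

theorem exists_sq_add_sq_add_three_sq {n : ℕ} (hn : n % 3 ≠ 0) :
    ∃ x y z : ℤ, (n : ℤ) = x ^ 2 + y ^ 2 + 3 * z ^ 2 := by
  obtain ⟨a, b, c, h⟩ := exists_sq_add_mul_add_sq_add_sq hn
  obtain ⟨u, v, huv⟩ := sq_add_mul_add_sq_eq a b
  exact ⟨u, c, v, by linarith⟩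

theorem exists_sq_add_three_sq_add_three_sq {n : ℕ} (hn : n % 3 = 1) :
    ∃ x y z : ℤ, (n : ℤ) = x ^ 2 + 3 * y ^ 2 + 3 * z ^ 2 := by
  obtain ⟨a, b, c, h⟩ := exists_three_mul_eq_sq_add_mul_add_sq_add_sq hn
  obtain ⟨u, v, huv⟩ := sq_add_mul_add_sq_eq a b
  rw [huv] at h
  have hu : u % 3 = 0 ∧ c % 3 = 0 := by
    rcases sq_emod_three u with h1 | h1 <;> rcases sq_emod_three c with h2 | h2 <;> omega
  obtain ⟨u, rfl⟩ : ∃ w, u = 3 * w := ⟨u / 3, by omega⟩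
  obtain ⟨c, rfl⟩ : ∃ w, c = 3 * w := ⟨c / 3, by omega⟩
  exact ⟨v, u, c, by linarith⟩

theorem exists_sq_add_six_sq_add_six_sq {n : ℕ} (hn : n % 3 = 1) (hn8 : n % 8 ≠ 3) :
    ∃ x y z : ℤ, (n : ℤ) = x ^ 2 + 6 * y ^ 2 + 6 * z ^ 2 := by
  have good : ∀ b p q : ℤ, (n : ℤ) = b ^ 2 + 3 * p ^ 2 + 3 * q ^ 2 → (p + q) % 2 = 0 →
      ∃ x y z : ℤ, (n : ℤ) = x ^ 2 + 6 * y ^ 2 + 6 * z ^ 2 := by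
    intro b p q h hpq
    obtain ⟨d, hd⟩ : ∃ d, p + q = 2 * d := ⟨(p + q) / 2, by omega⟩
    obtain rfl : p = 2 * d - q := by linarith
    exact ⟨b, d, q - d, by linarith⟩
  have bad : ∀ b p q : ℤ, (n : ℤ) = b ^ 2 + 3 * p ^ 2 + 3 * q ^ 2 → p % 2 = 1 → q % 2 = 0 →
      ∃ x y z : ℤ, (n : ℤ) = x ^ 2 + 6 * y ^ 2 + 6 * z ^ 2 := by
    intro b p q h hp hq
    rcases (by omega : b % 2 = 0 ∨ b % 2 = 1) with hb | hb
    · obtain ⟨c, rfl⟩ : ∃ c, b = 2 * c := ⟨b / 2, by omega⟩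
      obtain ⟨r, rfl⟩ : ∃ r, q = 2 * r := ⟨q / 2, by omega⟩
      -- Here `4(c² + 3r²) = (c - 3r)² + 3(c + r)²`; if `c + r` were even, `n` would be `3` modulo
      -- 8.
      refine good (c - 3 * r) p (c + r) (by linarith) ?_
      have hp' := sq_emod_four p
      have e : (2 * c) ^ 2 + 3 * (2 * r) ^ 2 = 4 * (c ^ 2 + 3 * r ^ 2) := by ring
      rcases sq_emod_four c with hc | hc <;> rcases sq_emod_four r with hr | hr <;> omega
    · obtain ⟨c, hc⟩ : ∃ c, b + p = 2 * c := ⟨(b + p) / 2, by omega⟩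
      obtain rfl : b = 2 * c - p := by linarith
      -- Now `b² + 3p² = 4(c² - cp + p²)` has two other representations by `u² + 3v²`, with `v = c`
      -- and `v = c - p`; one of these is even, like `q`.
      rcases (by omega : c % 2 = 0 ∨ (c - p) % 2 = 0) with h2 | h2
      · exact good (c - 2 * p) c q (by linarith) (by omega)
      · exact good (c + p) (c - p) q (by linarith) (by omega)
  obtain ⟨b, p, q, h⟩ := exists_sq_add_three_sq_add_three_sq hn
  by_cases hpq : (p + q) % 2 = 0
  · exact good b p q h hpq
  · rcases (by omega : p % 2 = 1 ∧ q % 2 = 0 ∨ q % 2 = 1 ∧ p % 2 = 0) with h' | h'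
    · exact bad b p q h h'.1 h'.2
    · exact bad b q p (by linarith) h'.1 h'.2

theorem exists_sq_add_sq_add_six_sq {n : ℕ} (hn : n % 3 = 1) :
    ∃ x y z : ℤ, (n : ℤ) = x ^ 2 + y ^ 2 + 6 * z ^ 2 := by
  rcases Nat.even_or_odd' n with ⟨m, hm | hm⟩
  · obtain ⟨x, y, z, h⟩ := exists_sq_add_sq_add_three_sq (n := m) (by omega)
    exact ⟨x + y, x - y, z, by rw [hm]; push_cast; linarith⟩
  · obtain ⟨x, y, z, h⟩ := exists_of_disc_six (n := n) (by omega)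
    have hz : z % 2 = 0 := by
      by_contra hz
      obtain ⟨w, rfl⟩ : ∃ w, z = 2 * w + 1 := ⟨z / 2, by omega⟩
      have e : (n : ℤ) = x * (x + 1) + y * (y + 1) + 2 * (x * w + y * w + (2 * w + 1) ^ 2) := by
        rw [h]; ring
      have hx := (Int.even_mul_succ_self x).two_dvd
      have hy := (Int.even_mul_succ_self y).two_dvd
      omega
    obtain ⟨w, rfl⟩ : ∃ w, z = 2 * w := ⟨z / 2, by omega⟩
    exact ⟨x + w, y + w, w, by linarith⟩

theorem exists_sq_add_six_sq_add_nine_sq {n : ℕ} (hn : n % 3 = 1) :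
    ∃ x y z : ℤ, (n : ℤ) = x ^ 2 + 6 * y ^ 2 + 9 * z ^ 2 := by
  obtain ⟨x, y, z, h⟩ := exists_sq_add_sq_add_six_sq hn
  have hxy : x % 3 = 0 ∨ y % 3 = 0 := by
    rcases sq_emod_three x with h1 | h1 <;> rcases sq_emod_three y with h2 | h2 <;> omega
  rcases hxy with hx | hy
  · obtain ⟨w, rfl⟩ : ∃ w, x = 3 * w := ⟨x / 3, by omega⟩
    exact ⟨y, z, w, by linarith⟩
  · obtain ⟨w, rfl⟩ : ∃ w, y = 3 * w := ⟨y / 3, by omega⟩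
    exact ⟨x, z, w, by linarith⟩

/-- A nonzero value of `x² + 2 u²` has a representation that is primitive at `3`. -/
lemma exists_sq_add_two_sq_primitive (x u : ℤ) (h : x ≠ 0) :
    ∃ x' u' : ℤ, x ^ 2 + 2 * u ^ 2 = x' ^ 2 + 2 * u' ^ 2 ∧ ¬(x' % 3 = 0 ∧ u' % 3 = 0) := by
  induction hm : x.natAbs using Nat.strong_induction_on generalizing x u with
  | _ m ih =>
    by_cases hxu : x % 3 = 0 ∧ u % 3 = 0
    · obtain ⟨a, rfl⟩ : ∃ a, x = 3 * a := ⟨x / 3, by omega⟩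
      obtain ⟨v, rfl⟩ : ∃ v, u = 3 * v := ⟨u / 3, by omega⟩
      obtain ⟨b, w, hbw, hn⟩ := ih a.natAbs (by omega) a v (by omega) rfl
      -- Multiply `b + w√-2` by an element of norm 9, `±1 ± 2√-2`, with signs chosen so that the
      -- product is not divisible by 3.
      by_cases hs : (b + w) % 3 = 0
      · exact ⟨-b + 4 * w, -2 * b - w, by linarith, by omega⟩
      · exact ⟨-b - 4 * w, 2 * b - w, by linarith, by omega⟩
    · exact ⟨x, u, rfl, hxu⟩

theorem exists_sq_add_six_sq_add_twelve_sq {n : ℕ} (hn : n % 6 = 1) :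
    ∃ x y z : ℤ, (n : ℤ) = x ^ 2 + 6 * y ^ 2 + 12 * z ^ 2 := by
  have good : ∀ x y z : ℤ, (n : ℤ) = x ^ 2 + 2 * y ^ 2 + 4 * z ^ 2 → x % 3 ≠ 0 →
      ∃ x y z : ℤ, (n : ℤ) = x ^ 2 + 6 * y ^ 2 + 12 * z ^ 2 := by
    intro x y z h hx
    have hyz : (y - z) % 3 = 0 ∨ (y + z) % 3 = 0 := by
      have hy : y % 3 = 0 ∨ y % 3 = 1 ∨ y % 3 = 2 := by omega
      have hz : z % 3 = 0 ∨ z % 3 = 1 ∨ z % 3 = 2 := by omega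
      rcases sq_emod_three x with h1 | h1 <;> rcases sq_emod_three y with h2 | h2 <;>
        rcases sq_emod_three z with h3 | h3 <;> omega
    rcases hyz with hyz | hyz
    · obtain ⟨q, hq⟩ : ∃ q, y - z = 3 * q := ⟨(y - z) / 3, by omega⟩
      obtain rfl : y = z + 3 * q := by linarith
      exact ⟨x, z + q, q, by linarith⟩
    · obtain ⟨q, hq⟩ : ∃ q, y + z = 3 * q := ⟨(y + z) / 3, by omega⟩
      obtain rfl : y = -z + 3 * q := by linarith
      exact ⟨x, -z + q, q, by linarith⟩
  obtain ⟨x, y, z, h⟩ := exists_sq_add_two_sq_add_four_sq (n := n) (by omega)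
  by_cases hx : x % 3 = 0
  · have hx0 : x ≠ 0 := by
      rintro rfl
      omega
    obtain ⟨x', y', h', hn'⟩ := exists_sq_add_two_sq_primitive x y hx0
    refine good x' y' z (by linarith) ?_
    rcases sq_emod_three x with h1 | h1 <;> rcases sq_emod_three y with h2 | h2 <;>
      rcases sq_emod_three z with h3 | h3 <;> rcases sq_emod_three x' with h4 | h4 <;>
      rcases sq_emod_three y' with h5 | h5 <;> omega
  · exact good x y z h hx

theorem exists_two_mul_eq_sq_add_five_sq_add_ten_sq {n : ℕ} (hn : n % 5 = 3) :
    ∃ x y z : ℤ, 2 * (n : ℤ) = x ^ 2 + 5 * y ^ 2 + 10 * z ^ 2 := by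
  have key : ∀ x y z : ℤ, 5 * (n : ℤ) = x ^ 2 + y ^ 2 + 2 * z ^ 2 + x * y + x * z → x % 2 = 0 →
      ∃ x y z : ℤ, 2 * (n : ℤ) = x ^ 2 + 5 * y ^ 2 + 10 * z ^ 2 := by
    intro x y z h hx
    obtain ⟨c, rfl⟩ : ∃ c, x = 2 * c := ⟨x / 2, by omega⟩
    have e : 10 * (n : ℤ) = 2 * (y + c) ^ 2 + (2 * z + c) ^ 2 + 5 * c ^ 2 := by linarith
    -- The form `2A² + B²` is anisotropic modulo 5.
    have h5 : (y + c) % 5 = 0 ∧ (2 * z + c) % 5 = 0 := by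
      rcases sq_emod_five (y + c) with h1 | h1 | h1 <;>
        rcases sq_emod_five (2 * z + c) with h2 | h2 | h2 <;> omega
    obtain ⟨p, hp⟩ : ∃ p, y + c = 5 * p := ⟨(y + c) / 5, by omega⟩
    obtain ⟨q, hq⟩ : ∃ q, 2 * z + c = 5 * q := ⟨(2 * z + c) / 5, by omega⟩
    rw [hp, hq] at e
    exact ⟨c, q, p, by linarith⟩
  obtain ⟨x, y, z, h⟩ := exists_of_disc_five hn
  by_cases h1 : x % 2 = 0
  · exact key x y z h h1
  -- When `x` is odd, an automorphism of the form puts `-x - y - z` or `y - z` in its place, and one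
  -- of these is even.
  by_cases h2 : (x + y + z) % 2 = 0
  · exact key (-x - y - z) y z (by linarith) (by omega)
  · exact key (y - z) (-x - y) z (by linarith) (by omega)

/-! ### Quaternary sums with a linear constraint -/

theorem exists_nat_sum_of_sub_eq_one {n : ℕ} (hn : 0 < n) : ∃ x y z w : ℕ,
    n = x ^ 2 + y ^ 2 + z ^ 2 + 2 * w ^ 2 ∧ (x : ℤ) - (y : ℤ) = 1 := by
  obtain ⟨x, z, w, h⟩ := exists_sq_add_two_sq_add_four_sq (n := 2 * n - 1) (by omega)
  rw [Nat.cast_sub (by omega)] at h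
  push_cast at h
  have hx : x % 2 = 1 := by
    rcases sq_emod_four x with h1 | h1 <;> omega
  obtain ⟨y, hy⟩ : ∃ y : ℕ, (x.natAbs : ℤ) = 2 * y + 1 := ⟨x.natAbs / 2, by omega⟩
  refine ⟨y + 1, y, z.natAbs, w.natAbs, ?_, by push_cast; ring⟩
  rw [← Int.natAbs_sq x, hy] at h
  zify
  rw [sq_abs, sq_abs]
  linarith

theorem exists_sum_one_two_two_two {n : ℕ} (hn : 0 < n) : ∃ x y z w : ℤ,
    (n : ℤ) = x ^ 2 + 2 * y ^ 2 + 2 * z ^ 2 + 2 * w ^ 2 ∧ x + y + z = 1 := by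
  obtain ⟨x, Y, w, h⟩ := exists_sq_add_two_sq_add_four_sq (n := 2 * n - 1) (by omega)
  rw [Nat.cast_sub (by omega)] at h
  push_cast at h
  have hx : x % 2 = 1 := by
    rcases sq_emod_four x with h1 | h1 <;> omega
  have key : ∀ k Y : ℤ, 2 * (n : ℤ) - 1 = (2 * k + 1) ^ 2 + 2 * Y ^ 2 + 4 * w ^ 2 →
      (k + Y) % 2 = 0 → ∃ x y z w : ℤ,
      (n : ℤ) = x ^ 2 + 2 * y ^ 2 + 2 * z ^ 2 + 2 * w ^ 2 ∧ x + y + z = 1 := by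
    intro k Y h hkY
    obtain ⟨m, hm⟩ : ∃ m, k + Y = 2 * m := ⟨(k + Y) / 2, by omega⟩
    obtain rfl : Y = 2 * m - k := by linarith
    exact ⟨1 + k, m - k, -m, w, by linarith, by ring⟩
  obtain ⟨k, rfl⟩ : ∃ k, x = 2 * k + 1 := ⟨x / 2, by omega⟩
  by_cases hkY : (k + Y) % 2 = 0
  · exact key k Y (by linarith) hkY
  · exact key (-k - 1) Y (by linarith) (by omega)

theorem exists_sum_of_add_add_two_mul {n : ℕ} (hn : 0 < n) : ∃ x y z w : ℤ,
    (n : ℤ) = x ^ 2 + y ^ 2 + z ^ 2 + 2 * w ^ 2 ∧ x + y + 2 * z = 1 := by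
  -- On `x + y + 2z = 1`, `12n - 2 = (2 - 6z)² + 6(x - y)² + 6(2w)²`.
  obtain ⟨b, d, w, h⟩ := exists_sq_add_six_sq_add_six_sq (n := 12 * n - 2) (by omega) (by omega)
  rw [Nat.cast_sub (by omega)] at h
  push_cast at h
  have key : ∀ b a c : ℤ, 12 * (n : ℤ) - 2 = b ^ 2 + 6 * a ^ 2 + 6 * c ^ 2 → a % 2 = 1 →
      c % 2 = 0 → b % 6 = 2 → ∃ x y z w : ℤ,
      (n : ℤ) = x ^ 2 + y ^ 2 + z ^ 2 + 2 * w ^ 2 ∧ x + y + 2 * z = 1 := by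
    intro b a c h ha hc hb
    obtain ⟨w, rfl⟩ : ∃ w, c = 2 * w := ⟨c / 2, by omega⟩
    obtain ⟨m, rfl⟩ : ∃ m, a = 2 * m + 1 := ⟨a / 2, by omega⟩
    obtain ⟨z, rfl⟩ : ∃ z, b = 2 * (1 - 3 * z) := ⟨-(b / 6), by omega⟩
    exact ⟨1 - z + m, -z - m, z, w, by linarith, by ring⟩
  have key' : ∀ a c : ℤ, 12 * (n : ℤ) - 2 = b ^ 2 + 6 * a ^ 2 + 6 * c ^ 2 → a % 2 = 1 →
      c % 2 = 0 → ∃ x y z w : ℤ,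
      (n : ℤ) = x ^ 2 + y ^ 2 + z ^ 2 + 2 * w ^ 2 ∧ x + y + 2 * z = 1 := by
    intro a c h ha hc
    have h2 : b % 6 = 2 ∨ (-b) % 6 = 2 := by
      rcases sq_emod_four b with h1 | h1 <;> rcases sq_emod_three b with h2 | h2 <;> omega
    rcases h2 with h2 | h2
    · exact key b a c h ha hc h2
    · exact key (-b) a c (by linarith) ha hc h2
  rcases sq_emod_four d with h1 | h1 <;> rcases sq_emod_four w with h2 | h2 <;>
    rcases sq_emod_four b with h3 | h3
  all_goals first
    | omega
    | exact key' d w h h1.1 h2.1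
    | exact key' w d (by linarith) h2.1 h1.1

theorem exists_sum_one_four_one_two {n : ℕ} (hn : 0 < n) : ∃ x y z w : ℤ,
    (n : ℤ) = x ^ 2 + 4 * y ^ 2 + z ^ 2 + 2 * w ^ 2 ∧ x + 2 * y + 2 * z = 1 := by
  obtain ⟨x, y, z, w, h, hl⟩ := exists_sum_of_add_add_two_mul hn
  rcases (by omega : x % 2 = 0 ∨ y % 2 = 0) with hx | hy
  · obtain ⟨v, rfl⟩ : ∃ v, x = 2 * v := ⟨x / 2, by omega⟩
    exact ⟨y, v, z, w, by linarith, by linarith⟩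
  · obtain ⟨v, rfl⟩ : ∃ v, y = 2 * v := ⟨y / 2, by omega⟩
    exact ⟨x, v, z, w, by linarith, by linarith⟩

theorem exists_sum_of_add_add_three_mul {n : ℕ} (hn : 0 < n) : ∃ x y z w : ℤ,
    (n : ℤ) = x ^ 2 + 2 * y ^ 2 + 2 * z ^ 2 + 2 * w ^ 2 ∧ x + y + 3 * z = 1 := by
  have key : ∀ x t s w : ℤ, (n : ℤ) = x ^ 2 + t ^ 2 + s ^ 2 + 2 * w ^ 2 → x + t + 2 * s = 1 →
      (t + s) % 2 = 0 → ∃ x y z w : ℤ,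
      (n : ℤ) = x ^ 2 + 2 * y ^ 2 + 2 * z ^ 2 + 2 * w ^ 2 ∧ x + y + 3 * z = 1 := by
    intro x t s w h hl hp
    obtain ⟨z, hz⟩ : ∃ z, t + s = 2 * z := ⟨(t + s) / 2, by omega⟩
    obtain rfl : t = 2 * z - s := by linarith
    exact ⟨x, s - z, z, w, by linarith, by linarith⟩
  obtain ⟨x, y, z, w, h, hl⟩ := exists_sum_of_add_add_two_mul hn
  rcases (by omega : (y + z) % 2 = 0 ∨ (x + z) % 2 = 0) with hy | hx
  · exact key x y z w h hl hy
  · exact key y x z w (by linarith) (by linarith) hx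

theorem exists_sum_of_add_two_mul {n : ℕ} (hn : 0 < n) : ∃ x y z w : ℤ,
    (n : ℤ) = x ^ 2 + y ^ 2 + z ^ 2 + 2 * w ^ 2 ∧ y + z + 2 * w = 1 := by
  obtain ⟨m, d, x, h⟩ := exists_sq_add_two_sq_add_four_sq (n := 4 * n - 1) (by omega)
  rw [Nat.cast_sub (by omega)] at h
  push_cast at h
  have hm : m % 2 = 1 ∧ d % 2 = 1 := by
    rcases sq_emod_four m with h1 | h1 <;> rcases sq_emod_four d with h2 | h2 <;> omega
  have key : ∀ m : ℤ, 4 * (n : ℤ) - 1 = m ^ 2 + 2 * d ^ 2 + 4 * x ^ 2 → m % 4 = 1 →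
      ∃ x y z w : ℤ, (n : ℤ) = x ^ 2 + y ^ 2 + z ^ 2 + 2 * w ^ 2 ∧ y + z + 2 * w = 1 := by
    intro m h hm'
    obtain ⟨w, rfl⟩ : ∃ w, m = 1 - 4 * w := ⟨-(m / 4), by omega⟩
    obtain ⟨e, rfl⟩ : ∃ e, d = 2 * e + 1 := ⟨d / 2, by omega⟩
    exact ⟨x, 1 - w + e, -w - e, w, by linarith, by ring⟩
  rcases (by omega : m % 4 = 1 ∨ (-m) % 4 = 1) with h4 | h4
  · exact key m h h4
  · exact key (-m) (by linarith) h4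

theorem exists_sum_one_one_four_two {n : ℕ} (hn : 0 < n) : ∃ x y z w : ℤ,
    (n : ℤ) = x ^ 2 + y ^ 2 + 4 * z ^ 2 + 2 * w ^ 2 ∧ y + 2 * z + 2 * w = 1 := by
  obtain ⟨x, y, z, w, h, hl⟩ := exists_sum_of_add_two_mul hn
  rcases (by omega : y % 2 = 0 ∨ z % 2 = 0) with hy | hz
  · obtain ⟨v, rfl⟩ : ∃ v, y = 2 * v := ⟨y / 2, by omega⟩
    exact ⟨x, z, v, w, by linarith, by linarith⟩
  · obtain ⟨v, rfl⟩ : ∃ v, z = 2 * v := ⟨z / 2, by omega⟩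
    exact ⟨x, y, v, w, by linarith, by linarith⟩

theorem exists_sum_of_add_add_add_two_mul {n : ℕ} (hn : 0 < n) : ∃ x y z w : ℤ,
    (n : ℤ) = x ^ 2 + 2 * y ^ 2 + 2 * z ^ 2 + 2 * w ^ 2 ∧ x + y + z + 2 * w = 1 := by
  have key : ∀ t x s w : ℤ, (n : ℤ) = t ^ 2 + x ^ 2 + s ^ 2 + 2 * w ^ 2 → x + s + 2 * w = 1 →
      (t + s) % 2 = 0 → ∃ x y z w : ℤ,
      (n : ℤ) = x ^ 2 + 2 * y ^ 2 + 2 * z ^ 2 + 2 * w ^ 2 ∧ x + y + z + 2 * w = 1 := by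
    intro t x s w h hl hp
    obtain ⟨y, hy⟩ : ∃ y, t + s = 2 * y := ⟨(t + s) / 2, by omega⟩
    obtain rfl : t = 2 * y - s := by linarith
    exact ⟨x, y, s - y, w, by linarith, by linarith⟩
  obtain ⟨x, y, z, w, h, hl⟩ := exists_sum_of_add_two_mul hn
  rcases (by omega : (x + z) % 2 = 0 ∨ (x + y) % 2 = 0) with hz | hy
  · exact key x y z w h hl hz
  · exact key x z y w (by linarith) (by linarith) hy

theorem exists_sum_of_add_add {n : ℕ} (hn : 0 < n) : ∃ x y z w : ℤ,
    (n : ℤ) = x ^ 2 + y ^ 2 + z ^ 2 + 2 * w ^ 2 ∧ y + z + w = 1 := by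
  -- On `y + z + w = 1`, `2(5n - 2) = (1 - 5w)² + 5(y - z)² + 10x²`.
  obtain ⟨m, d, x, h⟩ :=
    exists_two_mul_eq_sq_add_five_sq_add_ten_sq (n := 5 * n - 2) (by omega)
  rw [Nat.cast_sub (by omega)] at h
  push_cast at h
  have key : ∀ m : ℤ, 2 * (5 * (n : ℤ) - 2) = m ^ 2 + 5 * d ^ 2 + 10 * x ^ 2 → m % 5 = 1 →
      ∃ x y z w : ℤ, (n : ℤ) = x ^ 2 + y ^ 2 + z ^ 2 + 2 * w ^ 2 ∧ y + z + w = 1 := by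
    intro m h hm
    have hp : (m + d) % 2 = 0 := by
      rcases sq_emod_four m with h1 | h1 <;> rcases sq_emod_four d with h2 | h2 <;> omega
    obtain ⟨w, rfl⟩ : ∃ w, m = 1 - 5 * w := ⟨-(m / 5), by omega⟩
    obtain ⟨y, hy⟩ : ∃ y, 1 - w + d = 2 * y := ⟨(1 - w + d) / 2, by omega⟩
    obtain rfl : d = 2 * y - 1 + w := by linarith
    exact ⟨x, y, 1 - w - y, w, by linarith, by ring⟩
  have hm : m % 5 = 1 ∨ (-m) % 5 = 1 := by
    rcases sq_emod_five m with h1 | h1 | h1 <;> omega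
  rcases hm with hm | hm
  · exact key m h hm
  · exact key (-m) (by linarith) hm

theorem exists_sum_one_one_two_five {n : ℕ} (hn : 0 < n) : ∃ x y z w : ℤ,
    (n : ℤ) = x ^ 2 + y ^ 2 + 2 * z ^ 2 + 5 * w ^ 2 ∧ y + w = 1 := by
  obtain ⟨m, x, z, h⟩ := exists_sq_add_six_sq_add_twelve_sq (n := 6 * n - 5) (by omega)
  rw [Nat.cast_sub (by omega)] at h
  push_cast at h
  have key : ∀ m : ℤ, 6 * (n : ℤ) - 5 = m ^ 2 + 6 * x ^ 2 + 12 * z ^ 2 → m % 6 = 1 →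
      ∃ x y z w : ℤ, (n : ℤ) = x ^ 2 + y ^ 2 + 2 * z ^ 2 + 5 * w ^ 2 ∧ y + w = 1 := by
    intro m h hm
    obtain ⟨w, rfl⟩ : ∃ w, m = 1 - 6 * w := ⟨-(m / 6), by omega⟩
    exact ⟨x, 1 - w, z, w, by linarith, by ring⟩
  have hm : m % 6 = 1 ∨ (-m) % 6 = 1 := by
    have h6 : m % 2 = 1 ∧ m % 3 ≠ 0 := by
      rcases sq_emod_four m with h1 | h1 <;> rcases sq_emod_three m with h2 | h2 <;> omega
    rcases (by omega : m % 6 = 1 ∨ m % 6 = 5) with h | h <;> omega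
  rcases hm with hm | hm
  · exact key m h hm
  · exact key (-m) (by linarith) hm

theorem exists_sum_one_one_two_six (H : ∀ m : ℕ, 0 < m → m ≡ 1 [MOD 7] → ∃ x y z : ℤ,
    (m : ℤ) = x ^ 2 + 7 * y ^ 2 + 14 * z ^ 2) {n : ℕ} (hn : 0 < n) : ∃ x y z w : ℤ,
    (n : ℤ) = x ^ 2 + y ^ 2 + 2 * z ^ 2 + 6 * w ^ 2 ∧ y + w = 1 := by
  obtain ⟨m, x, z, h⟩ := H (7 * n - 6) (by omega)
    (by change (7 * n - 6) % 7 = 1 % 7; omega)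
  rw [Nat.cast_sub (by omega)] at h
  push_cast at h
  have key : ∀ m : ℤ, 7 * (n : ℤ) - 6 = m ^ 2 + 7 * x ^ 2 + 14 * z ^ 2 → m % 7 = 1 →
      ∃ x y z w : ℤ, (n : ℤ) = x ^ 2 + y ^ 2 + 2 * z ^ 2 + 6 * w ^ 2 ∧ y + w = 1 := by
    intro m h hm
    obtain ⟨w, rfl⟩ : ∃ w, m = 1 - 7 * w := ⟨-(m / 7), by omega⟩
    exact ⟨x, 1 - w, z, w, by linarith, by ring⟩
  have hm : m % 7 = 1 ∨ (-m) % 7 = 1 := by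
    have h7 : m % 7 = 0 ∨ m % 7 = 1 ∨ m % 7 = 2 ∨ m % 7 = 3 ∨ m % 7 = 4 ∨ m % 7 = 5 ∨
      m % 7 = 6 := by omega
    have h2 : m ^ 2 % 7 = (m % 7) * (m % 7) % 7 := by rw [sq, Int.mul_emod]
    rcases h7 with h7 | h7 | h7 | h7 | h7 | h7 | h7 <;> rw [h7] at h2 <;> omega
  rcases hm with hm | hm
  · exact key m h hm
  · exact key (-m) (by linarith) hm

/-- A sign can be chosen so that an integer prime to `3` becomes `2` modulo `3`. -/
lemma exists_sq_eq_two_sub_three_mul {b : ℤ} (hb : b ^ 2 % 3 = 1) :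
    ∃ z : ℤ, b ^ 2 = (2 - 3 * z) ^ 2 := by
  have h : b % 3 = 2 ∨ (-b) % 3 = 2 := by
    rcases sq_emod_three b with h1 | h1 <;> omega
  rcases h with h | h
  · exact ⟨-(b / 3), by congr 1; omega⟩
  · exact ⟨-((-b) / 3), by rw [← neg_sq b]; congr 1; omega⟩

theorem exists_sum_one_one_one_three {n : ℕ} (hn : 0 < n) : ∃ x y z w : ℤ,
    (n : ℤ) = x ^ 2 + y ^ 2 + z ^ 2 + 3 * w ^ 2 ∧ x + y + 2 * z = 2 := by
  obtain ⟨b, d, w, h⟩ := exists_sq_add_six_sq_add_nine_sq (n := 3 * n - 2) (by omega)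
  rw [Nat.cast_sub (by omega)] at h
  push_cast at h
  obtain ⟨z, hz⟩ := exists_sq_eq_two_sub_three_mul (b := b) (by omega)
  exact ⟨1 - z + d, 1 - z - d, z, w, by linarith, by ring⟩

theorem exists_sum_of_add_add_eq_sq {n : ℕ} (hn : 4 < n) : ∃ x y z w : ℤ,
    (n : ℤ) = x ^ 2 + y ^ 2 + z ^ 2 + 2 * w ^ 2 ∧
      ∃ t : ℤ, (t = 1 ∨ t = 2) ∧ x + y + z = t ^ 2 := by
  -- The sum `x + y + z = t²` has the parity of `n`, which dictates `t`.
  rcases Nat.even_or_odd' n with ⟨k, rfl | rfl⟩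
  · obtain ⟨b, d, w, h⟩ := exists_sq_add_three_sq_add_three_sq (n := 3 * k - 8) (by omega)
    rw [Nat.cast_sub (by omega)] at h
    push_cast at h
    obtain ⟨v, hv⟩ := exists_sq_eq_two_sub_three_mul (b := b) (by omega)
    exact ⟨2 - v + d, 2 - v - d, 2 * v, w, by push_cast; linarith, 2, Or.inr rfl, by ring⟩
  · obtain ⟨b, d, w, h⟩ := exists_sq_add_three_sq_add_three_sq (n := 3 * k + 1) (by omega)
    push_cast at h
    obtain ⟨v, hv⟩ := exists_sq_eq_two_sub_three_mul (b := b) (by omega)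
    exact ⟨1 - v + d, 1 - v - d, 2 * v - 1, w, by push_cast; linarith, 1, Or.inl rfl, by ring⟩

theorem exists_sum_of_add_add_two_mul_eq_two_sq {n : ℕ} (hn : 7 < n) : ∃ x y z w : ℤ,
    (n : ℤ) = x ^ 2 + y ^ 2 + z ^ 2 + 2 * w ^ 2 ∧
      ∃ t : ℤ, (t = 1 ∨ t = 2) ∧ x + y + 2 * z = 2 * t ^ 2 := by
  -- Taking `t = 1` fails only for this residue; then `3n - 32 ≡ 5` modulo 8 allows `t = 2`, and `n
  -- ≡ 7` modulo 8 with `n > 7` keeps `3n - 32` positive.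
  by_cases h8 : (3 * n - 2) % 8 = 3
  · obtain ⟨b, d, w, h⟩ := exists_sq_add_six_sq_add_six_sq (n := 3 * n - 32) (by omega) (by omega)
    rw [Nat.cast_sub (by omega)] at h
    push_cast at h
    obtain ⟨v, hv⟩ := exists_sq_eq_two_sub_three_mul (b := b) (by omega)
    exact ⟨2 - v + d, 2 - v - d, v + 2, w, by linarith, 2, Or.inr rfl, by ring⟩
  · obtain ⟨b, d, w, h⟩ := exists_sq_add_six_sq_add_six_sq (n := 3 * n - 2) (by omega) h8
    rw [Nat.cast_sub (by omega)] at h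
    push_cast at h
    obtain ⟨z, hz⟩ := exists_sq_eq_two_sub_three_mul (b := b) (by omega)
    exact ⟨1 - z + d, 1 - z - d, z, w, by linarith, 1, Or.inl rfl, by ring⟩

theorem theorem1p5 :
    -- (i)
    ((∀ n : ℕ, 0 < n → ∃ x y z w : ℕ,
        n = x ^ 2 + y ^ 2 + z ^ 2 + 2 * w ^ 2 ∧ (x : ℤ) - (y : ℤ) = 1) ∧
      (∀ n : ℕ, 0 < n → ∃ x y z w : ℤ,
        (n : ℤ) = x ^ 2 + 2 * y ^ 2 + 2 * z ^ 2 + 2 * w ^ 2 ∧ x + y + z = 1)) ∧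
    -- (ii)
    ((∀ n : ℕ, 0 < n → ∃ x y z w : ℤ,
        (n : ℤ) = x ^ 2 + y ^ 2 + z ^ 2 + 2 * w ^ 2 ∧ x + y + 2 * z = 1) ∧
      (∀ n : ℕ, 0 < n → ∃ x y z w : ℤ,
        (n : ℤ) = x ^ 2 + 4 * y ^ 2 + z ^ 2 + 2 * w ^ 2 ∧ x + 2 * y + 2 * z = 1) ∧
      (∀ n : ℕ, 0 < n → ∃ x y z w : ℤ,
        (n : ℤ) = x ^ 2 + 2 * y ^ 2 + 2 * z ^ 2 + 2 * w ^ 2 ∧ x + y + 3 * z = 1)) ∧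
    -- (iii)
    ((∀ n : ℕ, 0 < n → ∃ x y z w : ℤ,
        (n : ℤ) = x ^ 2 + y ^ 2 + z ^ 2 + 2 * w ^ 2 ∧ y + z + 2 * w = 1) ∧
      (∀ n : ℕ, 0 < n → ∃ x y z w : ℤ,
        (n : ℤ) = x ^ 2 + y ^ 2 + 4 * z ^ 2 + 2 * w ^ 2 ∧ y + 2 * z + 2 * w = 1) ∧
      (∀ n : ℕ, 0 < n → ∃ x y z w : ℤ,
        (n : ℤ) = x ^ 2 + 2 * y ^ 2 + 2 * z ^ 2 + 2 * w ^ 2 ∧ x + y + z + 2 * w = 1)) ∧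
    -- (iv)
    (∀ n : ℕ, 0 < n → ∃ x y z w : ℤ,
        (n : ℤ) = x ^ 2 + y ^ 2 + z ^ 2 + 2 * w ^ 2 ∧ y + z + w = 1) ∧
    -- (v)
    ((∀ n : ℕ, 0 < n → ∃ x y z w : ℤ,
        (n : ℤ) = x ^ 2 + y ^ 2 + 2 * z ^ 2 + 5 * w ^ 2 ∧ y + w = 1) ∧
      ((∀ m : ℕ, 0 < m → m ≡ 1 [MOD 7] → ∃ x y z : ℤ,
          (m : ℤ) = x ^ 2 + 7 * y ^ 2 + 14 * z ^ 2) →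
        ∀ n : ℕ, 0 < n → ∃ x y z w : ℤ,
          (n : ℤ) = x ^ 2 + y ^ 2 + 2 * z ^ 2 + 6 * w ^ 2 ∧ y + w = 1)) ∧
    -- (vi)
    (∀ n : ℕ, 0 < n → ∃ x y z w : ℤ,
        (n : ℤ) = x ^ 2 + y ^ 2 + z ^ 2 + 3 * w ^ 2 ∧ x + y + 2 * z = 2) ∧
    -- (vii)
    (∀ n : ℕ, 4 < n → ∃ x y z w : ℤ,
        (n : ℤ) = x ^ 2 + y ^ 2 + z ^ 2 + 2 * w ^ 2 ∧
          ∃ t : ℤ, (t = 1 ∨ t = 2) ∧ x + y + z = t ^ 2) ∧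
    -- (viii)
    (∀ n : ℕ, 7 < n → ∃ x y z w : ℤ,
        (n : ℤ) = x ^ 2 + y ^ 2 + z ^ 2 + 2 * w ^ 2 ∧
          ∃ t : ℤ, (t = 1 ∨ t = 2) ∧ x + y + 2 * z = 2 * t ^ 2) := by
  exact ⟨⟨fun _ h => exists_nat_sum_of_sub_eq_one h, fun _ h => exists_sum_one_two_two_two h⟩,
    ⟨fun _ h => exists_sum_of_add_add_two_mul h, fun _ h => exists_sum_one_four_one_two h,
      fun _ h => exists_sum_of_add_add_three_mul h⟩,
    ⟨fun _ h => exists_sum_of_add_two_mul h, fun _ h => exists_sum_one_one_four_two h,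
      fun _ h => exists_sum_of_add_add_add_two_mul h⟩,
    fun _ h => exists_sum_of_add_add h,
    ⟨fun _ h => exists_sum_one_one_two_five h, fun H _ h => exists_sum_one_one_two_six H h⟩,
    fun _ h => exists_sum_one_one_one_three h, fun _ h => exists_sum_of_add_add_eq_sq h,
    fun _ h => exists_sum_of_add_add_two_mul_eq_two_sq h⟩
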